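/- **Setting.** $M\ge 1$ base stations with $N_{\rm t}\ge 1$ antennas each serve a finite set $\mathcal S$ of requests $\rho=(k,f,l)$ (receiver $k$ asks for subfile $l$ of file $f$) in the presence of an eavesdropper with $N_{\rm e}\ge 1$ antennas. Let $N=MN_{\rm t}$. The channel vectors $\mathbf h_\rho\in\mathbb C^{N}$, the estimate $\widehat{\mathbf G}\in\mathbb C^{N\times N_{\rm e}}$ of the eavesdropper's channel matrix, the radius $\varepsilon_{\rm e}\ge 0$, the noise levels $\sigma,\sigma_{\rm e}>0$, the power budgets $P_m^{\max}$, the required rates $R_\rho^{\rm req}$ and the tolerable eavesdropping rates $R_{{\rm e},\rho}^{\rm tol}$ are given, and the cooperation sets are fixed: $q_{f,l,m}=1$ if base station $m$ cooperates in sending subfile $(f,l)$, and $q_{f,l,m}=0$ otherwise. Let $\boldsymbol\Lambda_m$ be the diagonal $0/1$ matrix selecting the antennas of base station $m$, $\mathbf w_{m,\rho}$ the block of $\mathbf w_\rho\in\mathbb C^N$ belonging to base station $m$, and $\mathbf H_\rho=\mathbf h_\rho\mathbf h_\rho^H$. Set $\kappa_\rho^{\rm req}=2^{R_\rho^{\rm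 req}}-1$, $\kappa_\rho^{\rm tol}=\sigma_{\rm e}^2(2^{R_{{\rm e},\rho}^{\rm tol}}-1)$ and $\mathbf Z_{\rm e}(\mathbf G)=\mathbf I+\sigma_{\rm e}^{-2}\mathbf G^H\mathbf V\mathbf G$. **Problem R0.** Minimize the total transmit power $\mathrm{tr}\big(\sum_{\rho}\mathbf w_\rho\mathbf w_\rho^H+\mathbf V\big)$ over $(\mathbf w_\rho)_{\rho\in\mathcal S}$ and $\mathbf V\succeq\mathbf 0$ subject to, for all $m$ and all $\rho=(k,f,l)\in\mathcal S$: - $(1-q_{f,l,m})\mathbf w_{m,\rho}=\mathbf 0$; - $\mathrm{tr}\big(\boldsymbol\Lambda_m(\sum_{\rho'}\mathbf w_{\rho'}\mathbf w_{\rho'}^H+\mathbf V)\big)\le P_m^{\max}$; - $\log_2(1+\Gamma_\rho)\ge R_\rho^{\rm req}$, where $\Gamma_\rho=\dfrac{\sigma^{-2}|\mathbf h_\rho^H\mathbf w_\rho|^2}{1+\sigma^{-2}\sum_{\rho'\ne\rho}|\mathbf h_\rho^H\mathbf w_{\rho'}|^2+\sigma^{-2}\mathbf h_\rho^H\mathbf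 V\mathbf h_\rho}$; - $\log_2\det\big(\mathbf I+\sigma_{\rm e}^{-2}\mathbf G\,\mathbf Z_{\rm e}(\mathbf G)^{-1}\mathbf G^H\mathbf w_\rho\mathbf w_\rho^H\big)\le R_{{\rm e},\rho}^{\rm tol}$ for all $\mathbf G=\widehat{\mathbf G}+\Delta\mathbf G$ with $\|\Delta\mathbf G\|_F^2\le\varepsilon_{\rm e}^2$. **Problem R1** (semidefinite relaxation). Minimize $\mathrm{tr}\big(\sum_\rho\mathbf W_\rho+\mathbf V\big)$ over $\mathbf W_\rho\succeq\mathbf 0$ ($\rho\in\mathcal S$), $\mathbf V\succeq\mathbf 0$ and real numbers $\delta_\rho$ subject to, for all $m$ and all $\rho=(k,f,l)\in\mathcal S$: - $\mathrm{tr}(\boldsymbol\Lambda_m\mathbf W_\rho)\le q_{f,l,m}P_m^{\max}$; - $\mathrm{tr}\big(\boldsymbol\Lambda_m(\sum_{\rho'}\mathbf W_{\rho'}+\mathbf V)\big)\le P_m^{\max}$; - $\mathrm{tr}(\mathbf W_\rho\mathbf H_\rho)\ge\kappa_\rho^{\rm req}\big(\sigma^2+\sum_{\rho'\neq\rho}\mathrm{tr}(\mathbf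 W_{\rho'}\mathbf H_\rho)+\mathrm{tr}(\mathbf V\mathbf H_\rho)\big)$; - if $\varepsilon_{\rm e}>0$: $\delta_\rho\ge 0$ and $\mathbf U_{\rm e}^H\big(\mathbf W_\rho-\tfrac{\kappa_\rho^{\rm tol}}{\sigma_{\rm e}^2}\mathbf V\big)\mathbf U_{\rm e}\preceq\mathrm{diag}\big((\kappa_\rho^{\rm tol}-\delta_\rho)\mathbf I_{N_{\rm e}},\tfrac{\delta_\rho}{\varepsilon_{\rm e}^2}\mathbf I_{N}\big)$, where $\mathbf U_{\rm e}=[\widehat{\mathbf G},\mathbf I_N]$; - if $\varepsilon_{\rm e}=0$: $\widehat{\mathbf G}^H\mathbf W_\rho\widehat{\mathbf G}\preceq\kappa_\rho^{\rm tol}\,\mathbf Z_{\rm e}(\widehat{\mathbf G})$. **Theorem (rank of the optimal $\mathbf W_\rho$).** For every $\varepsilon_{\rm e}\ge0$, R0 and R1 have the same optimal value (infimum, $+\infty$ if infeasible), and R1 has an optimal solution if it is feasible. If $(\mathbf W_\rho^*,\mathbf V^*,\delta_\rho^*)$ is any optimal solution of R1, then $\mathrm{rank}(\mathbf W_\rho^*)\le1$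 for all $\rho\in\mathcal S$. Moreover, $\mathbf W^*_\rho$ has a principal eigenpair, and whenever $\lambda_\rho$ is the largest eigenvalue of $\mathbf W_\rho^*$ and $\mathbf u_\rho$ a unit eigenvector for it, the principal eigenvectors scaled as $\mathbf w_\rho^*=\sqrt{\lambda_\rho}\,\mathbf u_\rho$ satisfy $\mathbf W_\rho^*=\mathbf w_\rho^*(\mathbf w_\rho^*)^H$, and $(\mathbf w_\rho^*,\mathbf V^*)$ is an optimal solution of R0. Conversely, for every optimal solution $(\mathbf w_\rho,\mathbf V)$ of R0 there are $\delta_\rho$ such that $(\mathbf w_\rho\mathbf w_\rho^H,\mathbf V,\delta_\rho)$ is an optimal solution of R1. -/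

import Mathlib

open scoped ComplexOrder Matrix

noncomputable section

/-- A minimization problem over `α`: a feasible set and a real objective function. -/
structure MinProblem (α : Type*) where
  feasible : Set α
  objective : α → ℝ

/-- The optimal value: the infimum of the objective over the feasible set, in the extended reals
(so an infeasible problem has optimal value `+∞`). -/
def MinProblem.optimalValue {α : Type*} (P : MinProblem α) : EReal :=
  ⨅ x ∈ P.feasible, (P.objective x : EReal)

/-- `x` is an optimal solution: feasible, and minimizing the objective over the feasible set. -/
def MinProblem.IsOptimal {α : Type*} (P : MinProblem α) (x : α) : Prop :=
  x ∈ P.feasible ∧ ∀ y ∈ P.feasible, P.objective x ≤ P.objective y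

/-- A request `(k, f, l)`: receiver `k` asks for subfile `l` of file `f`. -/
abbrev Request (K F L : ℕ) : Type := Fin K × Fin F × Fin L

/-- Index of a transmit antenna: base station and antenna of that base station. -/
abbrev TxIdx (M Nt : ℕ) : Type := Fin M × Fin Nt

/-- The data of the delivery problem: `K` receivers, `F` files, `L` subfiles per file, `M` base
stations with `Nt` antennas each, and an eavesdropper with `Ne` antennas. -/
structure DeliveryData (K F L M Nt Ne : ℕ) where
  /-- the set of user requests -/
  S : Finset (Request K F L)
  /-- the fixed cooperation set of each subfile -/
  coop : Fin F → Fin L → Finset (Fin M)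
  /-- joint channel vector from all base stations to the receiver of a request -/
  h : S → (TxIdx M Nt → ℂ)
  /-- estimate of the eavesdropper's channel matrix -/
  Ghat : Matrix (TxIdx M Nt) (Fin Ne) ℂ
  /-- radius of the uncertainty set of the eavesdropper's channel -/
  ε : ℝ
  /-- standard deviation of the noise at the receivers -/
  σ : ℝ
  /-- standard deviation of the noise at the eavesdropper -/
  σe : ℝ
  /-- power budget of each base station -/
  Pmax : Fin M → ℝ
  /-- required rate -/
  Rreq : S → ℝ
  /-- tolerable eavesdropping rate -/
  Rtol : S → ℝ

/-- The matrix `w wᴴ`. -/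
def outer {n : Type*} (w : n → ℂ) : Matrix n n ℂ := Matrix.vecMulVec w (star w)

/-- `Λ_m`: the diagonal 0/1 matrix selecting the antennas of base station `m`. -/
def selMat {M : ℕ} (Nt : ℕ) (m : Fin M) : Matrix (TxIdx M Nt) (TxIdx M Nt) ℂ :=
  Matrix.diagonal fun i => if i.1 = m then 1 else 0

/-- `lam` is the largest eigenvalue of `A` and `u` a unit eigenvector for it. -/
def IsPrincipalEigenpair {n : Type*} [Fintype n] [DecidableEq n]
    (A : Matrix n n ℂ) (lam : ℝ) (u : n → ℂ) : Prop :=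
  ∑ i, ‖u i‖ ^ 2 = 1 ∧ A *ᵥ u = (lam : ℂ) • u ∧
    ∀ μ : ℝ, Module.End.HasEigenvalue (Matrix.toLin' A) (μ : ℂ) → μ ≤ lam

namespace DeliveryData

variable {K F L M Nt Ne : ℕ} (D : DeliveryData K F L M Nt Ne)

/-- `q_{f,l,m}` for the subfile of the request `ρ`: 1 if base station `m` cooperates, else 0. -/
def q (ρ : D.S) (m : Fin M) : ℝ := if m ∈ D.coop ρ.1.2.1 ρ.1.2.2 then 1 else 0

/-- The uncertainty set of the channel estimation error (Frobenius ball of radius `ε`). -/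
def uncertaintySet : Set (Matrix (TxIdx M Nt) (Fin Ne) ℂ) :=
  {Δ | ∑ i, ∑ j, ‖Δ i j‖ ^ 2 ≤ D.ε ^ 2}

/-- Received signal-to-interference-plus-noise ratio of the request `ρ`. -/
def sinr (w : D.S → TxIdx M Nt → ℂ) (V : Matrix (TxIdx M Nt) (TxIdx M Nt) ℂ) (ρ : D.S) : ℝ :=
  (1 / D.σ ^ 2 * ‖star (D.h ρ) ⬝ᵥ w ρ‖ ^ 2) /
    (1 + 1 / D.σ ^ 2 * ∑ ρ' ∈ Finset.univ.erase ρ, ‖star (D.h ρ) ⬝ᵥ w ρ'‖ ^ 2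
      + 1 / D.σ ^ 2 * (star (D.h ρ) ⬝ᵥ V *ᵥ D.h ρ).re)

/-- Achievable rate of the request `ρ`. -/
def rate (w : D.S → TxIdx M Nt → ℂ) (V : Matrix (TxIdx M Nt) (TxIdx M Nt) ℂ) (ρ : D.S) : ℝ :=
  Real.logb 2 (1 + D.sinr w V ρ)

/-- `Z_e = I + σe⁻² Gᴴ V G`. -/
def Ze (V : Matrix (TxIdx M Nt) (TxIdx M Nt) ℂ) (G : Matrix (TxIdx M Nt) (Fin Ne) ℂ) :
    Matrix (Fin Ne) (Fin Ne) ℂ :=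
  1 + ((1 / D.σe ^ 2 : ℝ) : ℂ) • (Gᴴ * V * G)

/-- Capacity of the eavesdropper, for channel matrix `G`, for the data sent with beamformer `w`.
For positive semidefinite `V` the determinant is a real number at least 1. -/
def eveRate (w : TxIdx M Nt → ℂ) (V : Matrix (TxIdx M Nt) (TxIdx M Nt) ℂ)
    (G : Matrix (TxIdx M Nt) (Fin Ne) ℂ) : ℝ :=
  Real.logb 2
    (Matrix.det (1 + ((1 / D.σe ^ 2 : ℝ) : ℂ) • (G * (D.Ze V G)⁻¹ * Gᴴ * outer w))).re

/-- The beamforming and jamming problem for fixed cooperation sets. The variables are the joint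
beamformers `w ρ` and the covariance matrix `V` of the jamming signal; the objective is the total
transmit power. -/
def R0 : MinProblem ((D.S → TxIdx M Nt → ℂ) × Matrix (TxIdx M Nt) (TxIdx M Nt) ℂ) where
  feasible := {x |
    x.2.PosSemidef ∧
    -- only cooperating base stations transmit
    (∀ ρ m, ∀ a : Fin Nt, (1 - (D.q ρ m : ℂ)) * x.1 ρ (m, a) = 0) ∧
    -- power budget of each base station
    (∀ m, (Matrix.trace (selMat Nt m * (∑ ρ, outer (x.1 ρ) + x.2))).re ≤ D.Pmax m) ∧
    -- required rate
    (∀ ρ, D.Rreq ρ ≤ D.rate x.1 x.2 ρ) ∧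
    -- robust secrecy
    (∀ ρ, ∀ Δ ∈ D.uncertaintySet, D.eveRate (x.1 ρ) x.2 (D.Ghat + Δ) ≤ D.Rtol ρ)}
  objective := fun x => (Matrix.trace (∑ ρ, outer (x.1 ρ) + x.2)).re

/-- `κ_ρ^req = 2 ^ R_ρ^req - 1`. -/
def κreq (ρ : D.S) : ℝ := (2 : ℝ) ^ D.Rreq ρ - 1

/-- `κ_ρ^tol = σe² (2 ^ R_ρ^tol - 1)`. -/
def κtol (ρ : D.S) : ℝ := D.σe ^ 2 * ((2 : ℝ) ^ D.Rtol ρ - 1)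

/-- `U_e = [Ĝ, I]`. -/
def Ue : Matrix (TxIdx M Nt) (Fin Ne ⊕ TxIdx M Nt) ℂ := Matrix.fromCols D.Ghat 1

/-- The secrecy constraint for `ε > 0`: `δ ≥ 0` and the linear matrix inequality
`U_eᴴ (W - (κ_ρ^tol / σe²) V) U_e ⪯ diag ((κ_ρ^tol - δ) 1, (δ / ε²) 1)`. -/
def RobustLMI (W V : Matrix (TxIdx M Nt) (TxIdx M Nt) ℂ) (δ : ℝ) (ρ : D.S) : Prop :=
  0 ≤ δ ∧
  (Matrix.diagonal (Sum.elim (fun _ : Fin Ne => ((D.κtol ρ - δ : ℝ) : ℂ))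
      (fun _ : TxIdx M Nt => ((δ / D.ε ^ 2 : ℝ) : ℂ)))
    - D.Ueᴴ * (W - ((D.κtol ρ / D.σe ^ 2 : ℝ) : ℂ) • V) * D.Ue).PosSemidef

/-- The secrecy constraint for `ε = 0`: `Gᴴ W G ⪯ κ_ρ^tol Z_e`, with `G = Ĝ`. -/
def NominalLMI (W V : Matrix (TxIdx M Nt) (TxIdx M Nt) ℂ) (ρ : D.S) : Prop :=
  ((D.κtol ρ : ℂ) • D.Ze V D.Ghat - D.Ghatᴴ * W * D.Ghat).PosSemidef

/-- The semidefinite relaxation. The variables are the matrices `W ρ`, the covariance matrix `V`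
and the multipliers `δ ρ`, one for each matrix inequality (they play no role if `ε = 0`). -/
def R1 : MinProblem ((D.S → Matrix (TxIdx M Nt) (TxIdx M Nt) ℂ) ×
    Matrix (TxIdx M Nt) (TxIdx M Nt) ℂ × (D.S → ℝ)) where
  feasible := {x |
    (∀ ρ, (x.1 ρ).PosSemidef) ∧ x.2.1.PosSemidef ∧
    (∀ ρ m, (Matrix.trace (selMat Nt m * x.1 ρ)).re ≤ D.q ρ m * D.Pmax m) ∧
    (∀ m, (Matrix.trace (selMat Nt m * (∑ ρ, x.1 ρ + x.2.1))).re ≤ D.Pmax m) ∧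
    -- required rate; for `κ_ρ^req > 0` one may divide by `κ_ρ^req`
    (∀ ρ, D.κreq ρ * (D.σ ^ 2
        + ∑ ρ' ∈ Finset.univ.erase ρ, (Matrix.trace (x.1 ρ' * outer (D.h ρ))).re
        + (Matrix.trace (x.2.1 * outer (D.h ρ))).re)
      ≤ (Matrix.trace (x.1 ρ * outer (D.h ρ))).re) ∧
    (0 < D.ε → ∀ ρ, D.RobustLMI (x.1 ρ) x.2.1 (x.2.2 ρ) ρ) ∧
    (D.ε = 0 → ∀ ρ, D.NominalLMI (x.1 ρ) x.2.1 ρ)}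
  objective := fun x => (Matrix.trace (∑ ρ, x.1 ρ + x.2.1)).re

end DeliveryData

end

/-!
The relaxation is exact for two reasons, neither of which uses duality or a constraint qualification.

On matrices `W ρ = w wᴴ` the two problems have the same constraints (`mem_R0_iff`). The rate
constraint only has to be cleared of its denominator. The secrecy constraint for one channel `G` is,
by the matrix determinant lemma, a bound on `wᴴ G Z_e⁻¹ Gᴴ w`, equivalently
`Gᴴ w wᴴ G ⪯ κ_ρ^tol Z_e` (`eveRate_le_iff`). Requiring it for all `G = Ĝ + Δ` with `‖Δ‖ ≤ ε` says
that a quadratic inequality in `(y, Δ y)` holds wherever `‖Δ y‖² ≤ ε² ‖y‖²`, and for `ε > 0` the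
S-procedure for two Hermitian forms (`exists_posSemidef_sub_smul`) turns this into the linear matrix
inequality of the relaxation. Over the complex numbers the S-procedure is lossless because the phase
of `c` in `x + c y` can be chosen to cancel the mixed term of one form and to give the mixed term of
the other a sign.

From any feasible point of the relaxation, each `W ρ` may be replaced by `(W ρ h)(W ρ h)ᴴ / (hᴴ W ρ
h)`, with `h = h_ρ`, or by `0` if `hᴴ W ρ h = 0`. By the Cauchy–Schwarz inequality this matrix is
below `W ρ`, so power, interference and eavesdropping do not grow, while the useful power `hᴴ W ρ h`
stays the same (`exists_outer_mem_R1`). The point remains feasible and its objective drops by the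
trace of the difference, which is positive unless `W ρ` already has that form. Hence optimal
solutions have rank at most one and the optimal values agree. The minimum of the relaxation is
attained by compactness (`exists_isOptimal_R1`).
-/

/-! ### Hermitian forms -/

section Forms

variable {n m : Type*} [Fintype n] [Fintype m]

/-- The value `xᴴ A x` of the quadratic form of a matrix, as a real number (the imaginary part
vanishes for Hermitian `A`). -/
def quadForm (A : Matrix n n ℂ) (x : n → ℂ) : ℝ := (star x ⬝ᵥ A *ᵥ x).re

lemma quadForm_add (A B : Matrix n n ℂ) (x : n → ℂ) :
    quadForm (A + B) x = quadForm A x + quadForm B x := by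
  simp [quadForm, Matrix.add_mulVec]

lemma quadForm_sub (A B : Matrix n n ℂ) (x : n → ℂ) :
    quadForm (A - B) x = quadForm A x - quadForm B x := by
  simp [quadForm, Matrix.sub_mulVec]

lemma quadForm_smul (c : ℝ) (A : Matrix n n ℂ) (x : n → ℂ) :
    quadForm ((c : ℂ) • A) x = c * quadForm A x := by
  simp [quadForm, Matrix.smul_mulVec]

lemma star_dotProduct_self (x : n → ℂ) : star x ⬝ᵥ x = ((∑ i, ‖x i‖ ^ 2 : ℝ) : ℂ) := by
  simp [dotProduct, Complex.conj_mul']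

lemma quadForm_conj (B : Matrix n m ℂ) (A : Matrix n n ℂ) (x : m → ℂ) :
    quadForm (Bᴴ * A * B) x = quadForm A (B *ᵥ x) := by
  simp only [quadForm, Matrix.star_mulVec, ← Matrix.dotProduct_mulVec, Matrix.mulVec_mulVec,
    Matrix.mul_assoc]

lemma quadForm_outer (w x : n → ℂ) : quadForm (outer w) x = ‖star w ⬝ᵥ x‖ ^ 2 := by
  rw [quadForm, outer, Matrix.vecMulVec_mulVec, dotProduct_smul, Matrix.star_dotProduct x w,
    op_smul_eq_mul, Complex.star_def, Complex.conj_mul']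
  norm_cast

lemma quadForm_one [DecidableEq n] (x : n → ℂ) :
    quadForm (1 : Matrix n n ℂ) x = ∑ i, ‖x i‖ ^ 2 := by
  rw [quadForm, Matrix.one_mulVec, star_dotProduct_self, Complex.ofReal_re]

lemma trace_mul_outer (A : Matrix n n ℂ) (h : n → ℂ) :
    (Matrix.trace (A * outer h)).re = quadForm A h := by
  rw [outer, Matrix.mul_vecMulVec, Matrix.trace_vecMulVec, dotProduct_comm, quadForm]

lemma isHermitian_outer (w : n → ℂ) : (outer w).IsHermitian :=
  (Matrix.posSemidef_vecMulVec_self_star w).1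

lemma posSemidef_outer (w : n → ℂ) : (outer w).PosSemidef :=
  Matrix.posSemidef_vecMulVec_self_star w

omit [Fintype n] in
lemma isHermitian_real_smul (c : ℝ) {A : Matrix n n ℂ} (hA : A.IsHermitian) :
    ((c : ℂ) • A).IsHermitian := by
  rw [Matrix.IsHermitian, Matrix.conjTranspose_smul, hA.eq]
  simp

lemma star_dotProduct_mulVec_swap {A : Matrix n n ℂ} (hA : A.IsHermitian) (x y : n → ℂ) :
    star y ⬝ᵥ A *ᵥ x = star (star x ⬝ᵥ A *ᵥ y) := by
  rw [Matrix.star_dotProduct, Matrix.star_mulVec, hA.eq, Matrix.dotProduct_mulVec]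

lemma ofReal_quadForm {A : Matrix n n ℂ} (hA : A.IsHermitian) (x : n → ℂ) :
    (quadForm A x : ℂ) = star x ⬝ᵥ A *ᵥ x := by
  rw [quadForm]
  exact Complex.conj_eq_iff_re.mp (star_dotProduct_mulVec_swap hA x x).symm

lemma posSemidef_iff_quadForm {A : Matrix n n ℂ} :
    A.PosSemidef ↔ A.IsHermitian ∧ ∀ x, 0 ≤ quadForm A x := by
  rw [Matrix.posSemidef_iff_dotProduct_mulVec]
  refine and_congr_right fun hA => forall_congr' fun x => ?_
  rw [← ofReal_quadForm hA, Complex.zero_le_real]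

lemma Matrix.PosSemidef.quadForm_nonneg {A : Matrix n n ℂ} (hA : A.PosSemidef) (x : n → ℂ) :
    0 ≤ quadForm A x :=
  (posSemidef_iff_quadForm.1 hA).2 x

lemma quadForm_add_smul {A : Matrix n n ℂ} (hA : A.IsHermitian) (x y : n → ℂ) (c : ℂ) :
    quadForm A (x + c • y) =
      quadForm A x + 2 * (c * (star x ⬝ᵥ A *ᵥ y)).re + ‖c‖ ^ 2 * quadForm A y := by
  have h1 : star y ⬝ᵥ A *ᵥ x = star (star x ⬝ᵥ A *ᵥ y) := star_dotProduct_mulVec_swap hA x y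
  have h2 : star (x + c • y) ⬝ᵥ A *ᵥ (x + c • y) =
      star x ⬝ᵥ A *ᵥ x + (c * (star x ⬝ᵥ A *ᵥ y) + star (c * (star x ⬝ᵥ A *ᵥ y))) +
        (star c * c) * (star y ⬝ᵥ A *ᵥ y) := by
    simp only [star_add, star_smul, Matrix.mulVec_add, Matrix.mulVec_smul, add_dotProduct,
      dotProduct_add, smul_dotProduct, dotProduct_smul, h1, star_mul', smul_eq_mul]
    ring
  rw [quadForm, h2, Complex.star_def, Complex.conj_mul', ← Complex.ofReal_pow,
    Complex.add_re, Complex.add_re, Complex.add_re, Complex.conj_re, Complex.re_ofReal_mul,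
    quadForm, quadForm]
  ring

/-- The Cauchy–Schwarz inequality for the form of a positive semidefinite matrix. -/
lemma Matrix.PosSemidef.cauchy_schwarz {A : Matrix n n ℂ} (hA : A.PosSemidef) (x y : n → ℂ) :
    ‖star x ⬝ᵥ A *ᵥ y‖ ^ 2 ≤ quadForm A x * quadForm A y := by
  set b := star x ⬝ᵥ A *ᵥ y with hb
  have key : ∀ t : ℝ, 0 ≤ quadForm A x - 2 * (t * ‖b‖ ^ 2) + t ^ 2 * ‖b‖ ^ 2 * quadForm A y := by
    intro t
    have h := hA.quadForm_nonneg (x + (-(t : ℂ) * star b) • y)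
    rw [quadForm_add_smul hA.1, ← hb, mul_assoc, Complex.star_def, Complex.conj_mul'] at h
    have e1 : (-(t : ℂ) * (‖b‖ : ℂ) ^ 2).re = -(t * ‖b‖ ^ 2) := by
      norm_cast
      ring
    have e2 : ‖-(t : ℂ) * (starRingEnd ℂ) b‖ ^ 2 = t ^ 2 * ‖b‖ ^ 2 := by
      rw [norm_mul, norm_neg, Complex.norm_real, RCLike.norm_conj, mul_pow, Real.norm_eq_abs,
        sq_abs]
    rw [e1, e2] at h
    linarith
  rcases (hA.quadForm_nonneg y).eq_or_lt' with h0 | h0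
  · rw [h0, mul_zero]
    -- with `yᴴ A y = 0` the bound is affine in `t`, which forces `b = 0`
    by_contra! hpos
    have hb0 : ‖b‖ ≠ 0 := by
      rintro h
      simp [h] at hpos
    have := key ((quadForm A x + 1) / (2 * ‖b‖ ^ 2))
    rw [h0, mul_zero, add_zero] at this
    field_simp at this
    linarith
  · have := key (1 / quadForm A y)
    field_simp at this
    linarith

/-! ### The S-procedure -/

/-- There is a complex number of prescribed modulus `r` for which the real part of its product
with `a` vanishes and the real part of its product with `b` is not positive. -/
lemma exists_phase (a b : ℂ) {r : ℝ} (hr : 0 ≤ r) :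
    ∃ c : ℂ, ‖c‖ = r ∧ (c * a).re = 0 ∧ (c * b).re ≤ 0 := by
  obtain ⟨c, hc, hca⟩ : ∃ c : ℂ, ‖c‖ = r ∧ (c * a).re = 0 := by
    by_cases ha : a = 0
    · exact ⟨r, by simp [abs_of_nonneg hr], by simp [ha]⟩
    · have ha' : ‖a‖ ≠ 0 := norm_ne_zero_iff.2 ha
      refine ⟨(r / ‖a‖ : ℝ) * (Complex.I * (starRingEnd ℂ) a), ?_, ?_⟩
      · rw [norm_mul, norm_mul, RCLike.norm_conj, Complex.norm_real, Complex.norm_I,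
          Real.norm_of_nonneg (by positivity)]
        field_simp
      · rw [mul_assoc, mul_assoc, Complex.conj_mul', Complex.re_ofReal_mul, ← Complex.ofReal_pow,
          Complex.I_mul_re, Complex.ofReal_im]
        simp
  rcases le_total (c * b).re 0 with h | h
  · exact ⟨c, hc, hca, h⟩
  · exact ⟨-c, by rw [norm_neg, hc], by rw [neg_mul, Complex.neg_re, hca, neg_zero],
      by rw [neg_mul, Complex.neg_re]; linarith⟩

/-- The lossless S-procedure for two Hermitian forms: if `A` takes a positive value and `B` is
nonnegative wherever `A` is, then `B - t A` is positive semidefinite for some `t ≥ 0`. The number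
`t` is the infimum of `(yᴴ B y) / (yᴴ A y)` over the `y` with `yᴴ A y > 0`. -/
theorem exists_posSemidef_sub_smul {A B : Matrix n n ℂ} (hA : A.IsHermitian) (hB : B.IsHermitian)
    (hpos : ∃ x, 0 < quadForm A x) (hAB : ∀ x, 0 ≤ quadForm A x → 0 ≤ quadForm B x) :
    ∃ t : ℝ, 0 ≤ t ∧ (B - (t : ℂ) • A).PosSemidef := by
  obtain ⟨x₀, hx₀⟩ := hpos
  set T : Set ℝ := {t | ∃ y, 0 < quadForm A y ∧ t = quadForm B y / quadForm A y}
  have hTne : T.Nonempty := ⟨_, x₀, hx₀, rfl⟩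
  have hT0 : ∀ t ∈ T, 0 ≤ t := by
    rintro t ⟨y, hy, rfl⟩
    exact div_nonneg (hAB y hy.le) hy.le
  have hTbdd : BddBelow T := ⟨0, hT0⟩
  -- the two forms are compared at a point `x + c y` where `A` vanishes
  have cross : ∀ x y, quadForm A x < 0 → 0 < quadForm A y →
      quadForm B x / quadForm A x ≤ quadForm B y / quadForm A y := by
    intro x y hx hy
    obtain ⟨c, hc, hca, hcb⟩ := exists_phase (star x ⬝ᵥ A *ᵥ y) (star x ⬝ᵥ B *ᵥ y)
      (Real.sqrt_nonneg (-quadForm A x / quadForm A y))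
    have hc2 : ‖c‖ ^ 2 = -quadForm A x / quadForm A y := by
      rw [hc, Real.sq_sqrt (div_nonneg (by linarith) hy.le)]
    have h0 : quadForm A (x + c • y) = 0 := by
      rw [quadForm_add_smul hA, hca, hc2]
      field_simp
      ring
    have h1 := hAB _ h0.ge
    rw [quadForm_add_smul hB, hc2] at h1
    have h2 : 0 ≤ quadForm B x + -quadForm A x / quadForm A y * quadForm B y := by linarith
    have h3 : -quadForm A x / quadForm A y * quadForm B y =
        -(quadForm A x * (quadForm B y / quadForm A y)) := by ring
    rw [div_le_iff_of_neg hx, mul_comm]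
    linarith
  refine ⟨sInf T, le_csInf hTne hT0, posSemidef_iff_quadForm.2
    ⟨hB.sub (isHermitian_real_smul _ hA), fun x => ?_⟩⟩
  rw [quadForm_sub, quadForm_smul, sub_nonneg]
  rcases lt_trichotomy (quadForm A x) 0 with hx | hx | hx
  · rw [← div_le_iff_of_neg hx]
    refine le_csInf hTne ?_
    rintro t ⟨y, hy, rfl⟩
    exact cross x y hx hy
  · rw [hx, mul_zero]
    exact hAB x hx.ge
  · rw [← le_div_iff₀ hx]
    exact csInf_le hTbdd ⟨x, hx, rfl⟩

/-! ### Rank-one matrices below a given matrix -/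

/-- For positive definite `Z`, the matrix `κ Z - x xᴴ` is positive semidefinite exactly when
`xᴴ Z⁻¹ x ≤ κ`. -/
lemma posSemidef_smul_sub_outer_iff [DecidableEq n] [Nonempty n] {Z : Matrix n n ℂ}
    (hZ : Z.PosDef) (x : n → ℂ) (κ : ℝ) :
    ((κ : ℂ) • Z - outer x).PosSemidef ↔ quadForm Z⁻¹ x ≤ κ := by
  have hdet : IsUnit Z.det := (Matrix.isUnit_iff_isUnit_det _).1 hZ.isUnit
  set z := Z⁻¹ *ᵥ x with hz
  have hZz : Z *ᵥ z = x := by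
    rw [hz, Matrix.mulVec_mulVec, Matrix.mul_nonsing_inv _ hdet, Matrix.one_mulVec]
  have hs : quadForm Z z = quadForm Z⁻¹ x := by
    rw [quadForm, hZz, Matrix.star_dotProduct, quadForm, hz, Complex.star_def, Complex.conj_re]
  have hxy : ∀ y, star x ⬝ᵥ y = star z ⬝ᵥ Z *ᵥ y := by
    intro y
    rw [← hZz, Matrix.star_mulVec, hZ.1.eq, ← Matrix.dotProduct_mulVec]
  have hs0 : 0 ≤ quadForm Z⁻¹ x := hZ.posSemidef.inv.quadForm_nonneg x
  constructor
  · intro h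
    have h1 := h.quadForm_nonneg z
    rw [quadForm_sub, quadForm_smul, quadForm_outer, hxy, ← ofReal_quadForm hZ.1,
      Complex.norm_real, Real.norm_eq_abs, sq_abs, hs] at h1
    rcases hs0.eq_or_lt' with h0 | h0
    · rw [h0]
      have h2 := h.quadForm_nonneg (fun _ => 1)
      rw [quadForm_sub, quadForm_smul, quadForm_outer] at h2
      have h3 : 0 < quadForm Z (fun _ => 1) := by
        have := hZ.dotProduct_mulVec_pos (x := fun _ => (1 : ℂ))
          (fun h => one_ne_zero (congrFun h (Classical.arbitrary n)))
        rwa [← ofReal_quadForm hZ.1, Complex.zero_lt_real] at this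
      nlinarith [sq_nonneg ‖star x ⬝ᵥ fun _ => (1 : ℂ)‖]
    · nlinarith
  · intro h
    refine posSemidef_iff_quadForm.2
      ⟨(isHermitian_real_smul _ hZ.1).sub (isHermitian_outer x), fun y => ?_⟩
    rw [quadForm_sub, quadForm_smul, quadForm_outer, hxy]
    have h1 := hZ.posSemidef.cauchy_schwarz z y
    rw [hs] at h1
    nlinarith [hZ.posSemidef.quadForm_nonneg y]

lemma det_one_add_mul_outer [DecidableEq n] (A : Matrix n n ℂ) (w : n → ℂ) :
    Matrix.det (1 + A * outer w) = 1 + star w ⬝ᵥ A *ᵥ w := by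
  rw [outer, Matrix.mul_vecMulVec, Matrix.vecMulVec_eq Unit,
    Matrix.det_one_add_replicateCol_mul_replicateRow]

/-- Below a positive semidefinite matrix `W` there is a matrix `v vᴴ` with the same value at `h`:
take `v = W h / √(hᴴ W h)`, or `v = 0` if `hᴴ W h = 0`. -/
lemma exists_outer_le {W : Matrix n n ℂ} (hW : W.PosSemidef) (h : n → ℂ) :
    ∃ v, (W - outer v).PosSemidef ∧ quadForm (outer v) h = quadForm W h := by
  rcases (hW.quadForm_nonneg h).eq_or_lt' with h0 | h0
  · exact ⟨0, by simpa [outer] using hW, by simp [quadForm_outer, h0]⟩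
  · refine ⟨((1 / √(quadForm W h) : ℝ) : ℂ) • W *ᵥ h, ?_⟩
    have hq : ∀ y, quadForm (outer (((1 / √(quadForm W h) : ℝ) : ℂ) • W *ᵥ h)) y =
        ‖star h ⬝ᵥ W *ᵥ y‖ ^ 2 / quadForm W h := by
      intro y
      rw [quadForm_outer, star_smul, smul_dotProduct, Matrix.star_mulVec, hW.1.eq,
        ← Matrix.dotProduct_mulVec, norm_smul, mul_pow, norm_star, Complex.norm_real,
        Real.norm_eq_abs, sq_abs, div_pow, Real.sq_sqrt h0.le]
      ring
    constructor
    · refine posSemidef_iff_quadForm.2 ⟨hW.1.sub (isHermitian_outer _), fun y => ?_⟩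
      rw [quadForm_sub, hq, sub_nonneg, div_le_iff₀' h0]
      exact hW.cauchy_schwarz h y
    · rw [hq, ← ofReal_quadForm hW.1, Complex.norm_real, Real.norm_eq_abs, sq_abs]
      field_simp

end Forms

/-! ### The secrecy constraint -/

lemma outer_conjTranspose_mulVec {n m : Type*} [Fintype n] (G : Matrix n m ℂ) (w : n → ℂ) :
    outer (Gᴴ *ᵥ w) = Gᴴ * outer w * G := by
  rw [outer, outer, Matrix.mul_vecMulVec, Matrix.vecMulVec_mul, Matrix.star_mulVec,
    Matrix.conjTranspose_conjTranspose]

/-- A matrix moves a vector by at most its Frobenius norm times the norm of the vector. -/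
lemma sum_norm_sq_mulVec_le {n m : Type*} [Fintype n] [Fintype m] (A : Matrix n m ℂ) (y : m → ℂ) :
    ∑ i, ‖(A *ᵥ y) i‖ ^ 2 ≤ (∑ i, ∑ j, ‖A i j‖ ^ 2) * ∑ j, ‖y j‖ ^ 2 := by
  rw [Finset.sum_mul]
  refine Finset.sum_le_sum fun i _ => ?_
  calc ‖(A *ᵥ y) i‖ ^ 2 ≤ (∑ j, ‖A i j‖ * ‖y j‖) ^ 2 := by
        gcongr
        exact (norm_sum_le _ _).trans_eq (by simp)
    _ ≤ _ := Finset.sum_mul_sq_le_sq_mul_sq _ _ _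

lemma quadForm_diagonal_sumElim {n m : Type*} [Fintype n] [Fintype m] [DecidableEq n]
    [DecidableEq m] (a b : ℝ) (y : n → ℂ) (v : m → ℂ) :
    quadForm (Matrix.diagonal (Sum.elim (fun _ : n => (a : ℂ)) (fun _ : m => (b : ℂ))))
      (Sum.elim y v) = a * ∑ i, ‖y i‖ ^ 2 + b * ∑ i, ‖v i‖ ^ 2 := by
  have e : ∀ (c : ℝ) (z : ℂ), ((starRingEnd ℂ) z * (c * z)).re = c * ‖z‖ ^ 2 := by
    intro c z
    rw [mul_left_comm, Complex.conj_mul', Complex.re_ofReal_mul, ← Complex.ofReal_pow,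
      Complex.ofReal_re]
  simp only [quadForm, dotProduct, Fintype.sum_sum_type, Matrix.mulVec_diagonal, Sum.elim_inl,
    Sum.elim_inr, Pi.star_apply, Complex.add_re, Complex.re_sum, Complex.star_def, e,
    Finset.mul_sum]

namespace DeliveryData

variable {K F L M Nt Ne : ℕ} (D : DeliveryData K F L M Nt Ne)

lemma posDef_Ze {V : Matrix (TxIdx M Nt) (TxIdx M Nt) ℂ} (hV : V.PosSemidef)
    (G : Matrix (TxIdx M Nt) (Fin Ne) ℂ) : (D.Ze V G).PosDef := by
  refine Matrix.PosDef.one.add_posSemidef ((hV.conjTranspose_mul_mul_same G).smul ?_)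
  rw [Complex.zero_le_real]
  positivity

lemma eveRate_eq (w : TxIdx M Nt → ℂ) (V : Matrix (TxIdx M Nt) (TxIdx M Nt) ℂ)
    (G : Matrix (TxIdx M Nt) (Fin Ne) ℂ) :
    D.eveRate w V G = Real.logb 2 (1 + quadForm (D.Ze V G)⁻¹ (Gᴴ *ᵥ w) / D.σe ^ 2) := by
  have h : quadForm (G * (D.Ze V G)⁻¹ * Gᴴ) w = quadForm (D.Ze V G)⁻¹ (Gᴴ *ᵥ w) := by
    rw [← quadForm_conj, Matrix.conjTranspose_conjTranspose]
  rw [eveRate, ← Matrix.smul_mul, det_one_add_mul_outer, Complex.add_re, Complex.one_re, ← quadForm,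
    quadForm_smul, h]
  congr 2
  ring

/-- The eavesdropping rate is tolerable exactly when the rank-one matrix inequality
`Gᴴ w wᴴ G ⪯ κ_ρ^tol Z_e` holds. -/
lemma eveRate_le_iff (hNe : 0 < Ne) (hσe : 0 < D.σe) (ρ : D.S) (w : TxIdx M Nt → ℂ)
    {V : Matrix (TxIdx M Nt) (TxIdx M Nt) ℂ} (hV : V.PosSemidef)
    (G : Matrix (TxIdx M Nt) (Fin Ne) ℂ) :
    D.eveRate w V G ≤ D.Rtol ρ ↔
      ((D.κtol ρ : ℂ) • D.Ze V G - Gᴴ * outer w * G).PosSemidef := by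
  have : Nonempty (Fin Ne) := ⟨⟨0, hNe⟩⟩
  have h0 := (D.posDef_Ze hV G).posSemidef.inv.quadForm_nonneg (Gᴴ *ᵥ w)
  have hσ2 : 0 < D.σe ^ 2 := by positivity
  rw [← outer_conjTranspose_mulVec, posSemidef_smul_sub_outer_iff (D.posDef_Ze hV G),
    D.eveRate_eq w V G, Real.logb_le_iff_le_rpow one_lt_two (by positivity), κtol,
    ← le_sub_iff_add_le', div_le_iff₀' hσ2]

lemma quadForm_smul_Ze_sub (c : ℝ) (W V : Matrix (TxIdx M Nt) (TxIdx M Nt) ℂ)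
    (G : Matrix (TxIdx M Nt) (Fin Ne) ℂ) (y : Fin Ne → ℂ) :
    quadForm ((c : ℂ) • D.Ze V G - Gᴴ * W * G) y =
      c * ∑ j, ‖y j‖ ^ 2 - quadForm (W - ((c / D.σe ^ 2 : ℝ) : ℂ) • V) (G *ᵥ y) := by
  rw [quadForm_sub, quadForm_smul, Ze, quadForm_add, quadForm_smul, quadForm_one, quadForm_conj,
    quadForm_conj, quadForm_sub, quadForm_smul]
  ring

lemma posSemidef_smul_Ze_sub_iff (c : ℝ) {W V : Matrix (TxIdx M Nt) (TxIdx M Nt) ℂ}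
    (hW : W.IsHermitian) (hV : V.PosSemidef) (G : Matrix (TxIdx M Nt) (Fin Ne) ℂ) :
    ((c : ℂ) • D.Ze V G - Gᴴ * W * G).PosSemidef ↔
      ∀ y, quadForm (W - ((c / D.σe ^ 2 : ℝ) : ℂ) • V) (G *ᵥ y) ≤ c * ∑ j, ‖y j‖ ^ 2 := by
  have hH : ((c : ℂ) • D.Ze V G - Gᴴ * W * G).IsHermitian :=
    (isHermitian_real_smul c (D.posDef_Ze hV G).1).sub
      (Matrix.isHermitian_conjTranspose_mul_mul G hW)
  simp only [posSemidef_iff_quadForm, hH, true_and, quadForm_smul_Ze_sub, sub_nonneg]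

lemma Ue_mulVec (y : Fin Ne → ℂ) (v : TxIdx M Nt → ℂ) :
    D.Ue *ᵥ Sum.elim y v = D.Ghat *ᵥ y + v := by
  rw [Ue, Matrix.fromCols_mulVec, Sum.elim_comp_inl, Sum.elim_comp_inr, Matrix.one_mulVec]

lemma robustLMI_iff {W V : Matrix (TxIdx M Nt) (TxIdx M Nt) ℂ} (hW : W.IsHermitian)
    (hV : V.IsHermitian) (δ : ℝ) (ρ : D.S) :
    D.RobustLMI W V δ ρ ↔ 0 ≤ δ ∧ ∀ y v,
      quadForm (W - ((D.κtol ρ / D.σe ^ 2 : ℝ) : ℂ) • V) (D.Ghat *ᵥ y + v) ≤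
        (D.κtol ρ - δ) * ∑ j, ‖y j‖ ^ 2 + δ / D.ε ^ 2 * ∑ i, ‖v i‖ ^ 2 := by
  refine and_congr_right fun _ => ?_
  rw [posSemidef_iff_quadForm, and_iff_right]
  · refine ⟨fun h y v => ?_, fun h x => ?_⟩
    · have := h (Sum.elim y v)
      rwa [quadForm_sub, quadForm_diagonal_sumElim, quadForm_conj, Ue_mulVec, sub_nonneg] at this
    · rw [← Sum.elim_comp_inl_inr x, quadForm_sub, quadForm_diagonal_sumElim, quadForm_conj,
        Ue_mulVec, sub_nonneg]
      exact h _ _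
  · refine (Matrix.isHermitian_diagonal_of_self_adjoint _ ?_).sub
      (Matrix.isHermitian_conjTranspose_mul_mul _ (hW.sub (isHermitian_real_smul _ hV)))
    ext (i | i) <;> simp

/-- Every vector `v` that is short enough relative to `y` is `Δ y` for some `Δ` in the uncertainty
set, namely `Δ = v yᴴ / ‖y‖²`. -/
lemma exists_mem_uncertaintySet {y : Fin Ne → ℂ} {v : TxIdx M Nt → ℂ}
    (h : ∑ i, ‖v i‖ ^ 2 ≤ D.ε ^ 2 * ∑ j, ‖y j‖ ^ 2) :
    ∃ Δ ∈ D.uncertaintySet, Δ *ᵥ y = v := by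
  have hy0 : 0 ≤ ∑ j, ‖y j‖ ^ 2 := by positivity
  rcases hy0.eq_or_lt' with hy | hy
  · rw [hy, mul_zero] at h
    have hv : v = 0 := by
      have := (Finset.sum_eq_zero_iff_of_nonneg (fun i _ => by positivity)).1
        (h.antisymm (by positivity : 0 ≤ ∑ i, ‖v i‖ ^ 2))
      ext i
      simpa using this i (Finset.mem_univ i)
    refine ⟨0, ?_, by simp [hv]⟩
    simp only [uncertaintySet, Set.mem_ofPred_eq, Matrix.zero_apply, norm_zero]
    simp only [ne_eq, OfNat.ofNat_ne_zero, not_false_eq_true, zero_pow, Finset.sum_const_zero]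
    positivity
  · refine ⟨((1 / ∑ j, ‖y j‖ ^ 2 : ℝ) : ℂ) • Matrix.vecMulVec v (star y), ?_, ?_⟩
    · have e : ∀ i j, ‖(((1 / ∑ j, ‖y j‖ ^ 2 : ℝ) : ℂ) • Matrix.vecMulVec v (star y)) i j‖ ^ 2 =
          (1 / ∑ j, ‖y j‖ ^ 2) ^ 2 * (‖v i‖ ^ 2 * ‖y j‖ ^ 2) := by
        intro i j
        rw [Matrix.smul_apply, Matrix.vecMulVec_apply, smul_eq_mul, norm_mul, norm_mul,
          Complex.norm_real, mul_pow, mul_pow, Real.norm_eq_abs, sq_abs, Pi.star_apply, norm_star]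
      simp only [uncertaintySet, Set.mem_ofPred_eq, e, ← Finset.mul_sum, ← Finset.sum_mul]
      field_simp
      linarith
    · rw [Matrix.smul_mulVec, Matrix.vecMulVec_mulVec, star_dotProduct_self, op_smul_eq_smul,
        smul_smul, ← Complex.ofReal_mul, one_div_mul_cancel hy.ne', Complex.ofReal_one, one_smul]

/-- The secrecy constraint for all channels in the uncertainty set, as an implication between two
quadratic inequalities in `(y, Δ y)`. The Frobenius ball enters only through the vectors `Δ y`, so
the spectral ball of the same radius would give the same constraint. -/
lemma forall_eveRate_le_iff (hNe : 0 < Ne) (hσe : 0 < D.σe) (ρ : D.S) (w : TxIdx M Nt → ℂ)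
    {V : Matrix (TxIdx M Nt) (TxIdx M Nt) ℂ} (hV : V.PosSemidef) :
    (∀ Δ ∈ D.uncertaintySet, D.eveRate w V (D.Ghat + Δ) ≤ D.Rtol ρ) ↔
      ∀ y v, ∑ i, ‖v i‖ ^ 2 ≤ D.ε ^ 2 * ∑ j, ‖y j‖ ^ 2 →
        quadForm (outer w - ((D.κtol ρ / D.σe ^ 2 : ℝ) : ℂ) • V) (D.Ghat *ᵥ y + v) ≤
          D.κtol ρ * ∑ j, ‖y j‖ ^ 2 := by
  simp only [D.eveRate_le_iff hNe hσe ρ w hV,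
    D.posSemidef_smul_Ze_sub_iff _ (isHermitian_outer w) hV, Matrix.add_mulVec]
  constructor
  · intro h y v hv
    obtain ⟨Δ, hΔ, rfl⟩ := D.exists_mem_uncertaintySet hv
    exact h Δ hΔ y
  · intro h Δ hΔ y
    refine h y (Δ *ᵥ y) ((sum_norm_sq_mulVec_le Δ y).trans ?_)
    gcongr
    exact hΔ

/-- For `ε > 0` the robust secrecy constraint is a linear matrix inequality with a multiplier. -/
lemma forall_eveRate_le_iff_exists_robustLMI (hNe : 0 < Ne) (hσe : 0 < D.σe) (hε : 0 < D.ε)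
    (ρ : D.S) (w : TxIdx M Nt → ℂ) {V : Matrix (TxIdx M Nt) (TxIdx M Nt) ℂ}
    (hV : V.PosSemidef) :
    (∀ Δ ∈ D.uncertaintySet, D.eveRate w V (D.Ghat + Δ) ≤ D.Rtol ρ) ↔
      ∃ δ, D.RobustLMI (outer w) V δ ρ := by
  have hε2 : 0 < D.ε ^ 2 := by positivity
  rw [D.forall_eveRate_le_iff hNe hσe ρ w hV]
  simp only [D.robustLMI_iff (isHermitian_outer w) hV.1]
  constructor
  · intro h
    set A : Matrix (Fin Ne ⊕ TxIdx M Nt) (Fin Ne ⊕ TxIdx M Nt) ℂ :=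
      Matrix.diagonal (Sum.elim (fun _ => ((D.ε ^ 2 : ℝ) : ℂ)) (fun _ => ((-1 : ℝ) : ℂ))) with hAdef
    set B : Matrix (Fin Ne ⊕ TxIdx M Nt) (Fin Ne ⊕ TxIdx M Nt) ℂ :=
      Matrix.diagonal (Sum.elim (fun _ => (D.κtol ρ : ℂ)) (fun _ => ((0 : ℝ) : ℂ))) -
        D.Ueᴴ * (outer w - ((D.κtol ρ / D.σe ^ 2 : ℝ) : ℂ) • V) * D.Ue with hBdef
    have hAq : ∀ y v, quadForm A (Sum.elim y v) = D.ε ^ 2 * ∑ j, ‖y j‖ ^ 2 - ∑ i, ‖v i‖ ^ 2 := by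
      intro y v
      rw [hAdef, quadForm_diagonal_sumElim]
      ring
    have hBq : ∀ y v, quadForm B (Sum.elim y v) = D.κtol ρ * ∑ j, ‖y j‖ ^ 2 -
        quadForm (outer w - ((D.κtol ρ / D.σe ^ 2 : ℝ) : ℂ) • V) (D.Ghat *ᵥ y + v) := by
      intro y v
      rw [hBdef, quadForm_sub, quadForm_diagonal_sumElim, quadForm_conj, Ue_mulVec]
      ring
    have hA : A.IsHermitian := by
      refine Matrix.isHermitian_diagonal_of_self_adjoint _ ?_
      ext (i | i) <;> simp
    have hB : B.IsHermitian := by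
      refine (Matrix.isHermitian_diagonal_of_self_adjoint _ ?_).sub
        (Matrix.isHermitian_conjTranspose_mul_mul _
          ((isHermitian_outer w).sub (isHermitian_real_smul _ hV.1)))
      ext (i | i) <;> simp
    obtain ⟨t, ht, hpsd⟩ := exists_posSemidef_sub_smul hA hB
      ⟨Sum.elim (Pi.single ⟨0, hNe⟩ 1) 0, by
        rw [hAq, Finset.sum_eq_single ⟨0, hNe⟩ (fun j _ hj => by simp [hj]) (by simp)]
        simpa using hε2⟩
      (fun x hx => by
        rw [← Sum.elim_comp_inl_inr x, hAq, sub_nonneg] at hx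
        rw [← Sum.elim_comp_inl_inr x, hBq, sub_nonneg]
        exact h _ _ hx)
    -- the multiplier of `ε² ‖y‖² - ‖v‖² ≥ 0` is `δ / ε²`
    refine ⟨t * D.ε ^ 2, by positivity, fun y v => ?_⟩
    have := hpsd.quadForm_nonneg (Sum.elim y v)
    rw [quadForm_sub, quadForm_smul, hAq, hBq] at this
    rw [mul_div_cancel_right₀ _ hε2.ne']
    linarith
  · rintro ⟨δ, hδ, h⟩ y v hv
    refine (h y v).trans ?_
    have : δ / D.ε ^ 2 * ∑ i, ‖v i‖ ^ 2 ≤ δ * ∑ j, ‖y j‖ ^ 2 := by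
      calc _ ≤ δ / D.ε ^ 2 * (D.ε ^ 2 * ∑ j, ‖y j‖ ^ 2) := by gcongr
        _ = _ := by field_simp
    linarith

/-- For `ε = 0` the uncertainty set is `{0}`, and the secrecy constraint is one matrix
inequality. -/
lemma forall_eveRate_le_iff_nominalLMI (hNe : 0 < Ne) (hσe : 0 < D.σe) (hε : D.ε = 0)
    (ρ : D.S) (w : TxIdx M Nt → ℂ) {V : Matrix (TxIdx M Nt) (TxIdx M Nt) ℂ}
    (hV : V.PosSemidef) :
    (∀ Δ ∈ D.uncertaintySet, D.eveRate w V (D.Ghat + Δ) ≤ D.Rtol ρ) ↔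
      D.NominalLMI (outer w) V ρ := by
  rw [NominalLMI, ← D.eveRate_le_iff hNe hσe ρ w hV]
  constructor
  · intro h
    simpa using h 0 (by simp [uncertaintySet, hε])
  · intro h Δ hΔ
    have hΔ0 : Δ = 0 := by
      have h1 : ∑ i, ∑ j, ‖Δ i j‖ ^ 2 ≤ 0 := by simpa [uncertaintySet, hε] using hΔ
      have h2 := (Finset.sum_eq_zero_iff_of_nonneg (fun i _ => by positivity)).1
        (h1.antisymm (by positivity))
      ext i j
      have h3 := (Finset.sum_eq_zero_iff_of_nonneg (fun j _ => by positivity)).1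
        (h2 i (Finset.mem_univ i)) j (Finset.mem_univ j)
      simpa using h3
    rwa [hΔ0, add_zero]

/-! ### The rate constraint -/

/-- The rate constraint, cleared of the logarithm and of the denominator. -/
lemma le_rate_iff (hσ : 0 < D.σ) (w : D.S → TxIdx M Nt → ℂ)
    {V : Matrix (TxIdx M Nt) (TxIdx M Nt) ℂ} (hV : V.PosSemidef) (ρ : D.S) :
    D.Rreq ρ ≤ D.rate w V ρ ↔
      D.κreq ρ * (D.σ ^ 2 + ∑ ρ' ∈ Finset.univ.erase ρ, quadForm (outer (w ρ')) (D.h ρ)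
        + quadForm V (D.h ρ)) ≤ quadForm (outer (w ρ)) (D.h ρ) := by
  have e : ∀ ρ', quadForm (outer (w ρ')) (D.h ρ) = ‖star (D.h ρ) ⬝ᵥ w ρ'‖ ^ 2 := by
    intro ρ'
    rw [quadForm_outer, Matrix.star_dotProduct, norm_star]
  have hV0 := hV.quadForm_nonneg (D.h ρ)
  have hσ2 : 0 < D.σ ^ 2 := by positivity
  have hs : D.sinr w V ρ = quadForm (outer (w ρ)) (D.h ρ) / (D.σ ^ 2 +
      ∑ ρ' ∈ Finset.univ.erase ρ, quadForm (outer (w ρ')) (D.h ρ) + quadForm V (D.h ρ)) := by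
    simp only [sinr, e]
    rw [← quadForm]
    field_simp
  simp only [e] at hs ⊢
  have hden : 0 < D.σ ^ 2 + ∑ ρ' ∈ Finset.univ.erase ρ, ‖star (D.h ρ) ⬝ᵥ w ρ'‖ ^ 2
      + quadForm V (D.h ρ) := by positivity
  rw [rate, hs, Real.le_logb_iff_rpow_le one_lt_two (by positivity), κreq, ← sub_le_iff_le_add',
    le_div_iff₀ hden]

end DeliveryData

section Matrices

variable {n m : Type*} [Fintype n]

lemma outer_smul (c : ℂ) (v : n → ℂ) : outer (c • v) = ((‖c‖ ^ 2 : ℝ) : ℂ) • outer v := by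
  rw [outer, outer, star_smul, Matrix.smul_vecMulVec, Matrix.vecMulVec_smul, smul_smul,
    Complex.star_def, Complex.mul_conj']
  norm_cast

lemma outer_mulVec (v x : n → ℂ) : outer v *ᵥ x = (star v ⬝ᵥ x) • v := by
  rw [outer, Matrix.vecMulVec_mulVec, op_smul_eq_smul]

/-! ### Principal eigenpairs -/

/-- The largest eigenvalue of a Hermitian matrix is attained by a unit eigenvector. -/
lemma Matrix.IsHermitian.exists_isPrincipalEigenpair [DecidableEq n] [Nonempty n]
    {A : Matrix n n ℂ} (hA : A.IsHermitian) : ∃ lam u, IsPrincipalEigenpair A lam u := by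
  obtain ⟨j, hj⟩ := Finite.exists_max hA.eigenvalues
  refine ⟨hA.eigenvalues j, (hA.eigenvectorBasis j).ofLp, ?_, ?_, ?_⟩
  · have h := hA.eigenvectorBasis.orthonormal.1 j
    rw [EuclideanSpace.norm_eq, Real.sqrt_eq_one] at h
    exact h
  · exact_mod_cast hA.mulVec_eigenvectorBasis j
  · intro μ hμ
    rw [Module.End.hasEigenvalue_iff_mem_spectrum, Matrix.spectrum_toLin',
      hA.spectrum_eq_image_range] at hμ
    obtain ⟨_, ⟨i, rfl⟩, hi⟩ := hμ
    have : hA.eigenvalues i = μ := Complex.ofReal_injective hi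
    exact this ▸ hj i

/-- A matrix `v vᴴ` is recovered from its largest eigenvalue and any unit eigenvector for it. -/
lemma outer_eq_of_isPrincipalEigenpair [DecidableEq n] {v u : n → ℂ} {lam : ℝ}
    (h : IsPrincipalEigenpair (outer v) lam u) : outer v = outer (((√lam : ℝ) : ℂ) • u) := by
  obtain ⟨hu, hlam, hmax⟩ := h
  rw [outer_mulVec] at hlam
  have hu0 : u ≠ 0 := by
    rintro rfl
    simp at hu
  by_cases hv : v = 0
  · subst hv
    have : lam = 0 := by
      rw [smul_zero, eq_comm, smul_eq_zero] at hlam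
      exact_mod_cast hlam.resolve_right hu0
    simp [this]
  set s : ℝ := ∑ i, ‖v i‖ ^ 2 with hs
  have hvs : star v ⬝ᵥ v = (s : ℂ) := star_dotProduct_self v
  have hs0 : 0 < s := by
    have := Matrix.dotProduct_star_self_pos_iff.2 hv
    rwa [hvs, Complex.zero_lt_real] at this
  have hle : s ≤ lam := by
    refine hmax s (Module.End.hasEigenvalue_of_hasEigenvector (x := v) ⟨?_, hv⟩)
    rw [Module.End.mem_eigenspace_iff, Matrix.toLin'_apply, outer_mulVec, hvs]
  have hlam0 : (lam : ℂ) ≠ 0 := by exact_mod_cast (hs0.trans_le hle).ne'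
  set a := star v ⬝ᵥ u with ha
  have ha0 : a ≠ 0 := by
    intro h0
    rw [h0, zero_smul, eq_comm, smul_eq_zero] at hlam
    exact hlam.elim hlam0 hu0
  have hls : lam = s := by
    have h1 := congrArg (star v ⬝ᵥ ·) hlam
    simp only [dotProduct_smul, hvs, ← ha, smul_eq_mul] at h1
    rw [mul_comm] at h1
    exact_mod_cast (mul_right_cancel₀ ha0 h1).symm
  have huv : u = (a / lam) • v := by
    rw [div_eq_inv_mul, mul_smul, hlam, smul_smul, inv_mul_cancel₀ hlam0, one_smul]
  have hc : ‖a / (lam : ℂ)‖ ^ 2 * s = 1 := by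
    rw [huv] at hu
    simpa only [Pi.smul_apply, smul_eq_mul, norm_mul, mul_pow, ← Finset.mul_sum] using hu
  rw [← hls] at hc
  rw [outer_smul, huv, outer_smul, smul_smul, ← Complex.ofReal_mul, Complex.norm_real,
    Real.norm_eq_abs, sq_abs, Real.sq_sqrt (hs0.le.trans hle), mul_comm, hc, Complex.ofReal_one,
    one_smul]

/-! ### Trace bounds, closedness and compactness -/

lemma Matrix.PosSemidef.trace_re_nonneg {A : Matrix n n ℂ} (hA : A.PosSemidef) :
    0 ≤ (Matrix.trace A).re :=
  (Complex.le_def.1 hA.trace_nonneg).1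

lemma Matrix.PosSemidef.norm_apply_le_trace [DecidableEq n] {A : Matrix n n ℂ}
    (hA : A.PosSemidef) (i j : n) : ‖A i j‖ ≤ (Matrix.trace A).re := by
  have hd : ∀ k, 0 ≤ (A k k).re := fun k => (Complex.le_def.1 (hA.diag_nonneg (i := k))).1
  have hle : ∀ k, (A k k).re ≤ (Matrix.trace A).re := by
    intro k
    rw [Matrix.trace, Complex.re_sum]
    exact Finset.single_le_sum (f := fun k => (A k k).re) (fun k _ => hd k) (Finset.mem_univ k)
  have hs : ∀ k l, star (Pi.single k (1 : ℂ)) ⬝ᵥ A *ᵥ Pi.single l 1 = A k l := by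
    intro k l
    rw [← Pi.single_star, star_one, Matrix.mulVec_single_one, single_one_dotProduct]
    rfl
  have h := hA.cauchy_schwarz (Pi.single i 1) (Pi.single j 1)
  rw [quadForm, quadForm, hs, hs, hs] at h
  refine abs_le_of_sq_le_sq' (h.trans ?_) hA.trace_re_nonneg |>.2
  rw [sq]
  exact mul_le_mul (hle i) (hle j) (hd j) hA.trace_re_nonneg

lemma continuous_quadForm (x : n → ℂ) : Continuous fun A : Matrix n n ℂ => quadForm A x := by
  unfold quadForm
  fun_prop

lemma isClosed_setOf_posSemidef : IsClosed {A : Matrix n n ℂ | A.PosSemidef} := by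
  simp only [posSemidef_iff_quadForm, Set.ofPred_and, Set.ofPred_forall]
  refine IsClosed.inter ?_ (isClosed_iInter fun x =>
    isClosed_le continuous_const (continuous_quadForm x))
  exact isClosed_eq (by fun_prop) continuous_id

omit [Fintype n] in
lemma isCompact_setOf_norm_apply_le (c : ℝ) :
    IsCompact {A : Matrix n n ℂ | ∀ i j, ‖A i j‖ ≤ c} := by
  have : {A : Matrix n n ℂ | ∀ i j, ‖A i j‖ ≤ c} =
      Set.univ.pi fun _ => Set.univ.pi fun _ => Metric.closedBall (0 : ℂ) c := by
    ext A
    exact ⟨fun h i _ j _ => mem_closedBall_zero_iff.2 (h i j),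
      fun h i j => mem_closedBall_zero_iff.1 (h i trivial j trivial)⟩
  rw [this]
  exact isCompact_univ_pi fun _ => isCompact_univ_pi fun _ => isCompact_closedBall _ _

end Matrices

/-! ### Power of a base station -/

section Antennas

variable {M Nt : ℕ}

lemma trace_selMat_mul (m : Fin M) (A : Matrix (TxIdx M Nt) (TxIdx M Nt) ℂ) :
    (Matrix.trace (selMat Nt m * A)).re = ∑ a, (A (m, a) (m, a)).re := by
  simp only [selMat, Matrix.trace, Matrix.diag_apply, Matrix.diagonal_mul, Fintype.sum_prod_type,
    Complex.re_sum, ite_mul, one_mul, zero_mul]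
  rw [Finset.sum_eq_single m (fun b _ hb => by simp [hb]) (by simp)]
  simp

lemma trace_selMat_mul_outer (m : Fin M) (w : TxIdx M Nt → ℂ) :
    (Matrix.trace (selMat Nt m * outer w)).re = ∑ a, ‖w (m, a)‖ ^ 2 := by
  rw [trace_selMat_mul]
  refine Finset.sum_congr rfl fun a _ => ?_
  rw [outer, Matrix.vecMulVec_apply, Pi.star_apply, Complex.star_def, Complex.mul_conj']
  norm_cast

lemma trace_selMat_mul_nonneg (m : Fin M) {A : Matrix (TxIdx M Nt) (TxIdx M Nt) ℂ}
    (hA : A.PosSemidef) : 0 ≤ (Matrix.trace (selMat Nt m * A)).re := by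
  rw [trace_selMat_mul]
  exact Finset.sum_nonneg fun a _ => (Complex.le_def.1 hA.diag_nonneg).1

lemma trace_selMat_mul_le (m : Fin M) {A B : Matrix (TxIdx M Nt) (TxIdx M Nt) ℂ}
    (h : (B - A).PosSemidef) :
    (Matrix.trace (selMat Nt m * A)).re ≤ (Matrix.trace (selMat Nt m * B)).re := by
  have := trace_selMat_mul_nonneg m h
  rw [Matrix.mul_sub, Matrix.trace_sub, Complex.sub_re] at this
  linarith

end Antennas

namespace DeliveryData

variable {K F L M Nt Ne : ℕ} (D : DeliveryData K F L M Nt Ne)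

/-! ### Exactness of the relaxation -/

lemma RobustLMI.of_le {W W' V : Matrix (TxIdx M Nt) (TxIdx M Nt) ℂ} {δ : ℝ} {ρ : D.S}
    (h : D.RobustLMI W V δ ρ) (hW : (W - W').PosSemidef) : D.RobustLMI W' V δ ρ := by
  refine ⟨h.1, ?_⟩
  convert h.2.add (hW.conjTranspose_mul_mul_same D.Ue) using 1
  simp only [Matrix.mul_sub, Matrix.sub_mul]
  abel

lemma NominalLMI.of_le {W W' V : Matrix (TxIdx M Nt) (TxIdx M Nt) ℂ} {ρ : D.S}
    (h : D.NominalLMI W V ρ) (hW : (W - W').PosSemidef) : D.NominalLMI W' V ρ := by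
  unfold NominalLMI at h ⊢
  convert h.add (hW.conjTranspose_mul_mul_same D.Ghat) using 1
  simp only [Matrix.mul_sub, Matrix.sub_mul]
  abel

/-- For a rank-one matrix `w wᴴ` the relaxed cooperation constraint says that the blocks of `w` of
the base stations that do not cooperate vanish. -/
lemma trace_selMat_mul_outer_le_iff (ρ : D.S) (m : Fin M) (w : TxIdx M Nt → ℂ)
    (hP : (Matrix.trace (selMat Nt m * outer w)).re ≤ D.Pmax m) :
    (Matrix.trace (selMat Nt m * outer w)).re ≤ D.q ρ m * D.Pmax m ↔
      ∀ a : Fin Nt, (1 - (D.q ρ m : ℂ)) * w (m, a) = 0 := by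
  unfold q
  split_ifs with h
  · simpa using hP
  · rw [trace_selMat_mul_outer]
    simp only [zero_mul, Complex.ofReal_zero, sub_zero, one_mul]
    refine ⟨fun h0 a => ?_, fun h0 => by simp [h0]⟩
    have h1 := (Finset.sum_eq_zero_iff_of_nonneg (fun a _ => by positivity)).1
      (h0.antisymm (by positivity)) a (Finset.mem_univ a)
    simpa using h1

/-- On matrices of rank at most one the relaxation is exact. -/
lemma mem_R0_iff (hNe : 0 < Ne) (hσ : 0 < D.σ) (hσe : 0 < D.σe) (hε : 0 ≤ D.ε)
    (w : D.S → TxIdx M Nt → ℂ) (V : Matrix (TxIdx M Nt) (TxIdx M Nt) ℂ) :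
    (w, V) ∈ D.R0.feasible ↔ ∃ δ, (fun ρ => outer (w ρ), V, δ) ∈ D.R1.feasible := by
  have hbudget : ∀ (hV : V.PosSemidef) (ρ : D.S) (m : Fin M),
      (Matrix.trace (selMat Nt m * (∑ ρ, outer (w ρ) + V))).re ≤ D.Pmax m →
      (Matrix.trace (selMat Nt m * outer (w ρ))).re ≤ D.Pmax m := by
    intro hV ρ m h
    refine (trace_selMat_mul_le m ?_).trans h
    rw [← Finset.add_sum_erase _ _ (Finset.mem_univ ρ)]
    convert (Matrix.posSemidef_sum (Finset.univ.erase ρ)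
      fun ρ' _ => posSemidef_outer (w ρ')).add hV using 1
    abel
  simp only [R0, R1, Set.mem_ofPred_eq, fun A ρ => trace_mul_outer A (D.h ρ)]
  constructor
  · rintro ⟨hV, hcoop, hP, hrate, hsec⟩
    have hδ : ∃ δ : D.S → ℝ, 0 < D.ε → ∀ ρ, D.RobustLMI (outer (w ρ)) V (δ ρ) ρ := by
      rcases hε.eq_or_lt with h | h
      · exact ⟨0, fun h' => absurd h h'.ne⟩
      · choose δ hδ using fun ρ =>
          (D.forall_eveRate_le_iff_exists_robustLMI hNe hσe h ρ (w ρ) hV).1 (hsec ρ)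
        exact ⟨δ, fun _ => hδ⟩
    obtain ⟨δ, hδ⟩ := hδ
    exact ⟨δ, fun ρ => posSemidef_outer _, hV,
      fun ρ m => (D.trace_selMat_mul_outer_le_iff ρ m _ (hbudget hV ρ m (hP m))).2 (hcoop ρ m),
      hP, fun ρ => (D.le_rate_iff hσ w hV ρ).1 (hrate ρ), hδ,
      fun h ρ => (D.forall_eveRate_le_iff_nominalLMI hNe hσe h ρ _ hV).1 (hsec ρ)⟩
  · rintro ⟨δ, -, hV, hcoop, hP, hrate, hrob, hnom⟩
    refine ⟨hV,
      fun ρ m => (D.trace_selMat_mul_outer_le_iff ρ m _ (hbudget hV ρ m (hP m))).1 (hcoop ρ m),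
      hP, fun ρ => (D.le_rate_iff hσ w hV ρ).2 (hrate ρ), fun ρ => ?_⟩
    rcases hε.eq_or_lt with h | h
    · exact (D.forall_eveRate_le_iff_nominalLMI hNe hσe h.symm ρ _ hV).2 (hnom h.symm ρ)
    · exact (D.forall_eveRate_le_iff_exists_robustLMI hNe hσe h ρ _ hV).2 ⟨δ ρ, hrob h ρ⟩

/-- Every feasible point of the relaxation dominates one with matrices of rank at most one: `W ρ`
may be lowered as long as the useful power `h_ρᴴ W_ρ h_ρ` is kept. -/
lemma exists_outer_mem_R1 {W : D.S → Matrix (TxIdx M Nt) (TxIdx M Nt) ℂ}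
    {V : Matrix (TxIdx M Nt) (TxIdx M Nt) ℂ} {δ : D.S → ℝ} (h : (W, V, δ) ∈ D.R1.feasible) :
    ∃ w : D.S → TxIdx M Nt → ℂ, (fun ρ => outer (w ρ), V, δ) ∈ D.R1.feasible ∧
      ∀ ρ, (W ρ - outer (w ρ)).PosSemidef := by
  simp only [R1, Set.mem_ofPred_eq, fun A ρ => trace_mul_outer A (D.h ρ)] at h ⊢
  obtain ⟨hW, hV, hcoop, hP, hrate, hrob, hnom⟩ := h
  choose w hw hwh using fun ρ => exists_outer_le (hW ρ) (D.h ρ)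
  refine ⟨w, ⟨fun ρ => posSemidef_outer _, hV,
    fun ρ m => (trace_selMat_mul_le m (hw ρ)).trans (hcoop ρ m),
    fun m => (trace_selMat_mul_le m ?_).trans (hP m), fun ρ => ?_,
    fun hε ρ => RobustLMI.of_le D (hrob hε ρ) (hw ρ),
    fun hε ρ => NominalLMI.of_le D (hnom hε ρ) (hw ρ)⟩, hw⟩
  · rw [add_sub_add_right_eq_sub, ← Finset.sum_sub_distrib]
    exact Matrix.posSemidef_sum _ fun ρ _ => hw ρ
  · rw [hwh ρ]
    have hle : ∑ ρ' ∈ Finset.univ.erase ρ, quadForm (outer (w ρ')) (D.h ρ) ≤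
        ∑ ρ' ∈ Finset.univ.erase ρ, quadForm (W ρ') (D.h ρ) := by
      refine Finset.sum_le_sum fun ρ' _ => ?_
      have := (hw ρ').quadForm_nonneg (D.h ρ)
      rw [quadForm_sub] at this
      linarith
    rcases le_total 0 (D.κreq ρ) with hκ | hκ
    · refine le_trans ?_ (hrate ρ)
      gcongr
    -- a nonpositive required rate constrains nothing
    · refine (mul_nonpos_of_nonpos_of_nonneg hκ ?_).trans ((hW ρ).quadForm_nonneg _)
      have h1 := hV.quadForm_nonneg (D.h ρ)
      have h2 : 0 ≤ ∑ ρ' ∈ Finset.univ.erase ρ, quadForm (outer (w ρ')) (D.h ρ) :=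
        Finset.sum_nonneg fun ρ' _ => (posSemidef_outer _).quadForm_nonneg _
      exact add_nonneg (add_nonneg (sq_nonneg _) h2) h1

lemma objective_outer (w : D.S → TxIdx M Nt → ℂ) (V : Matrix (TxIdx M Nt) (TxIdx M Nt) ℂ)
    (δ : D.S → ℝ) :
    D.R1.objective (fun ρ => outer (w ρ), V, δ) = D.R0.objective (w, V) := rfl

lemma R1_objective_sub (W W' : D.S → Matrix (TxIdx M Nt) (TxIdx M Nt) ℂ)
    (V : Matrix (TxIdx M Nt) (TxIdx M Nt) ℂ) (δ : D.S → ℝ) :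
    D.R1.objective (W, V, δ) - D.R1.objective (W', V, δ) =
      ∑ ρ, (Matrix.trace (W ρ - W' ρ)).re := by
  simp only [R1, Matrix.trace_add, Matrix.trace_sum, Matrix.trace_sub, Complex.add_re,
    Complex.re_sum, Complex.sub_re, Finset.sum_sub_distrib]
  ring

/-! ### Existence of an optimal solution of the relaxation -/

lemma isClosed_R1_feasible : IsClosed D.R1.feasible := by
  simp only [R1, Set.ofPred_and, Set.ofPred_forall, trace_mul_outer]
  have hq : ∀ x, Continuous fun A : Matrix (TxIdx M Nt) (TxIdx M Nt) ℂ => quadForm A x :=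
    continuous_quadForm
  refine .inter (isClosed_iInter fun ρ => isClosed_setOf_posSemidef.preimage (by fun_prop))
    (.inter (isClosed_setOf_posSemidef.preimage (by fun_prop))
    (.inter (isClosed_iInter fun ρ => isClosed_iInter fun m => isClosed_le ?_ continuous_const)
    (.inter (isClosed_iInter fun m => isClosed_le ?_ continuous_const)
    (.inter (isClosed_iInter fun ρ => isClosed_le ?_ ?_)
    (.inter (isClosed_iInter fun _ => isClosed_iInter fun ρ => ?_)
    (isClosed_iInter fun _ => isClosed_iInter fun ρ => ?_))))))
  · fun_prop
  · fun_prop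
  · refine continuous_const.mul ((continuous_const.add (continuous_finsetSum _ fun ρ' _ =>
      (hq _).comp (by fun_prop))).add ((hq _).comp (by fun_prop)))
  · exact (hq _).comp (by fun_prop)
  · simp only [RobustLMI, Set.ofPred_and]
    refine .inter (isClosed_le continuous_const (by fun_prop))
      (isClosed_setOf_posSemidef.preimage ?_)
    refine Continuous.sub (Continuous.matrix_diagonal (continuous_pi ?_)) (by fun_prop)
    rintro (i | i) <;> simp only [Sum.elim_inl, Sum.elim_inr] <;> fun_prop
  · simp only [NominalLMI]
    refine isClosed_setOf_posSemidef.preimage ?_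
    unfold Ze
    fun_prop

/-- The relaxation attains its minimum: on a sublevel set of the objective the traces bound the
matrices, and the upper left block of the matrix inequality bounds the multipliers. -/
lemma exists_isOptimal_R1 (hNe : 0 < Ne) (hε : 0 ≤ D.ε) (hne : D.R1.feasible.Nonempty) :
    ∃ x, D.R1.IsOptimal x := by
  obtain ⟨x₀, hx₀⟩ := hne
  set c := D.R1.objective x₀ with hc
  set g : TxIdx M Nt → ℂ := D.Ghat *ᵥ Pi.single ⟨0, hNe⟩ 1 with hg
  obtain ⟨b, hb⟩ := (isCompact_setOf_norm_apply_le (n := TxIdx M Nt) c).bddAbove_image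
    (continuous_quadForm g).continuousOn
  set C : D.S → ℝ := fun ρ => D.κtol ρ + |D.κtol ρ / D.σe ^ 2| * b with hC
  set T : Set ((D.S → Matrix (TxIdx M Nt) (TxIdx M Nt) ℂ) ×
      Matrix (TxIdx M Nt) (TxIdx M Nt) ℂ × (D.S → ℝ)) :=
    (Set.univ.pi fun _ => {A | ∀ i j, ‖A i j‖ ≤ c}) ×ˢ {A | ∀ i j, ‖A i j‖ ≤ c} ×ˢ
      Set.univ.pi fun ρ => Set.Icc (min 0 (C ρ)) (max 0 (C ρ)) with hT
  have hTc : IsCompact T := (isCompact_univ_pi fun _ => isCompact_setOf_norm_apply_le c).prod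
    ((isCompact_setOf_norm_apply_le c).prod (isCompact_univ_pi fun _ => isCompact_Icc))
  -- for `ε = 0` the multipliers are free and may be taken to be `0`
  have key : ∀ x ∈ D.R1.feasible, D.R1.objective x ≤ c →
      ∃ y ∈ D.R1.feasible ∩ T, D.R1.objective y = D.R1.objective x := by
    rintro ⟨W, V, δ⟩ hx hle
    obtain ⟨hW, hV, hcoop, hP, hrate, hrob, hnom⟩ := hx
    have htr : ∑ ρ, (Matrix.trace (W ρ)).re + (Matrix.trace V).re ≤ c := by
      simpa only [R1, Matrix.trace_add, Matrix.trace_sum, Complex.add_re, Complex.re_sum]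
        using hle
    have htrV : (Matrix.trace V).re ≤ c := by
      have := Finset.sum_nonneg fun ρ (_ : ρ ∈ Finset.univ) => (hW ρ).trace_re_nonneg
      linarith
    have htrW : ∀ ρ, (Matrix.trace (W ρ)).re ≤ c := by
      intro ρ
      have := Finset.single_le_sum (f := fun ρ => (Matrix.trace (W ρ)).re)
        (fun ρ _ => (hW ρ).trace_re_nonneg) (Finset.mem_univ ρ)
      have := hV.trace_re_nonneg
      linarith
    have hVT : ∀ i j, ‖V i j‖ ≤ c := fun i j => (hV.norm_apply_le_trace i j).trans htrV
    have hWT : ∀ ρ i j, ‖W ρ i j‖ ≤ c :=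
      fun ρ i j => ((hW ρ).norm_apply_le_trace i j).trans (htrW ρ)
    rcases hε.eq_or_lt with h | h
    · refine ⟨(W, V, 0), ⟨⟨hW, hV, hcoop, hP, hrate, fun h' => absurd h h'.ne, hnom⟩,
        fun ρ _ => hWT ρ, hVT, fun ρ _ => ⟨min_le_left _ _, le_max_left _ _⟩⟩, rfl⟩
    · refine ⟨(W, V, δ), ⟨⟨hW, hV, hcoop, hP, hrate, hrob, hnom⟩,
        fun ρ _ => hWT ρ, hVT, fun ρ _ => ?_⟩, rfl⟩
      obtain ⟨hδ, hlmi⟩ := (D.robustLMI_iff (hW ρ).1 hV.1 (δ ρ) ρ).1 (hrob h ρ)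
      refine ⟨(min_le_left _ _).trans hδ, le_max_of_le_right ?_⟩
      have h1 := hlmi (Pi.single ⟨0, hNe⟩ 1) 0
      rw [Finset.sum_eq_single ⟨0, hNe⟩ (fun j _ hj => by simp [hj]) (by simp), add_zero, ← hg,
        quadForm_sub, quadForm_smul] at h1
      simp only [Pi.single_eq_same, norm_one, one_pow, mul_one, Pi.zero_apply, norm_zero, ne_eq,
        OfNat.ofNat_ne_zero, not_false_eq_true, zero_pow, Finset.sum_const_zero, mul_zero,
        add_zero] at h1
      have h2 : quadForm V g ≤ b := hb ⟨V, hVT, rfl⟩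
      have h3 : D.κtol ρ / D.σe ^ 2 * quadForm V g ≤ |D.κtol ρ / D.σe ^ 2| * b := by
        refine (mul_le_mul_of_nonneg_right (le_abs_self _) (hV.quadForm_nonneg g)).trans ?_
        gcongr
      have h4 := (hW ρ).quadForm_nonneg g
      show δ ρ ≤ D.κtol ρ + |D.κtol ρ / D.σe ^ 2| * b
      linarith
  obtain ⟨y₀, hy₀, hy₀c⟩ := key x₀ hx₀ le_rfl
  have hcont : Continuous D.R1.objective := by
    simp only [R1]
    fun_prop
  obtain ⟨x, hx, hmin⟩ := (hTc.inter_left D.isClosed_R1_feasible).exists_isMinOn ⟨y₀, hy₀⟩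
    hcont.continuousOn
  refine ⟨x, hx.1, fun y hy => ?_⟩
  rcases le_total (D.R1.objective y) c with h | h
  · obtain ⟨z, hz, hzy⟩ := key y hy h
    exact hzy ▸ hmin hz
  · exact ((hmin hy₀).trans_eq hy₀c).trans h

/-! ### Optimal solutions of the two problems -/

/-- An optimal solution of the relaxation consists of matrices `w wᴴ`: lowering them to that form
would otherwise save power. -/
lemma exists_eq_outer_of_isOptimal_R1 {W : D.S → Matrix (TxIdx M Nt) (TxIdx M Nt) ℂ}
    {V : Matrix (TxIdx M Nt) (TxIdx M Nt) ℂ} {δ : D.S → ℝ} (h : D.R1.IsOptimal (W, V, δ)) :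
    ∃ w : D.S → TxIdx M Nt → ℂ, ∀ ρ, W ρ = outer (w ρ) := by
  obtain ⟨w, hw, hle⟩ := D.exists_outer_mem_R1 h.1
  refine ⟨w, fun ρ => ?_⟩
  have h1 := h.2 _ hw
  have h2 := D.R1_objective_sub W (fun ρ => outer (w ρ)) V δ
  have h3 : (Matrix.trace (W ρ - outer (w ρ))).re = 0 :=
    (Finset.sum_eq_zero_iff_of_nonneg fun ρ _ => (hle ρ).trace_re_nonneg).1
      (le_antisymm (by linarith) (Finset.sum_nonneg fun ρ _ => (hle ρ).trace_re_nonneg))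
      ρ (Finset.mem_univ ρ)
  have h4 : Matrix.trace (W ρ - outer (w ρ)) = 0 :=
    Complex.ext h3 (Complex.le_def.1 (hle ρ).trace_nonneg).2.symm
  exact sub_eq_zero.1 ((hle ρ).trace_eq_zero_iff.1 h4)

/-- Every feasible point of the relaxation yields beamformers that need no more power. -/
lemma exists_mem_R0_of_mem_R1 (hNe : 0 < Ne) (hσ : 0 < D.σ) (hσe : 0 < D.σe) (hε : 0 ≤ D.ε)
    {x} (hx : x ∈ D.R1.feasible) : ∃ y ∈ D.R0.feasible, D.R0.objective y ≤ D.R1.objective x := by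
  obtain ⟨W, V, δ⟩ := x
  obtain ⟨w, hw, hle⟩ := D.exists_outer_mem_R1 hx
  refine ⟨(w, V), (D.mem_R0_iff hNe hσ hσe hε w V).2 ⟨δ, hw⟩, ?_⟩
  rw [← D.objective_outer w V δ, ← sub_nonneg, R1_objective_sub]
  exact Finset.sum_nonneg fun ρ _ => (hle ρ).trace_re_nonneg

end DeliveryData

theorem theorem1 {K F L M Nt Ne : ℕ} (hM : 0 < M) (hNt : 0 < Nt) (hNe : 0 < Ne)
    (D : DeliveryData K F L M Nt Ne) (hσ : 0 < D.σ) (hσe : 0 < D.σe) (hε : 0 ≤ D.ε) :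
    -- the two problems have the same optimal value
    D.R0.optimalValue = D.R1.optimalValue ∧
    -- the relaxation has an optimal solution as soon as it is feasible
    (D.R1.feasible.Nonempty → ∃ x, D.R1.IsOptimal x) ∧
    -- in every optimal solution of the relaxation the matrices `W ρ` have rank at most one, and
    -- their scaled principal eigenvectors are optimal beamformers
    (∀ (W : D.S → Matrix (TxIdx M Nt) (TxIdx M Nt) ℂ) (V : Matrix (TxIdx M Nt) (TxIdx M Nt) ℂ)
        (δ : D.S → ℝ), D.R1.IsOptimal (W, V, δ) →
      (∀ ρ, (W ρ).rank ≤ 1) ∧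
      (∀ ρ, ∃ lam u, IsPrincipalEigenpair (W ρ) lam u) ∧
      ∀ (lam : D.S → ℝ) (u : D.S → TxIdx M Nt → ℂ),
        (∀ ρ, IsPrincipalEigenpair (W ρ) (lam ρ) (u ρ)) →
        (∀ ρ, W ρ = outer (((√(lam ρ) : ℝ) : ℂ) • u ρ)) ∧
        D.R0.IsOptimal (fun ρ => ((√(lam ρ) : ℝ) : ℂ) • u ρ, V)) ∧
    -- every optimal solution of the original problem arises in this way
    (∀ (w : D.S → TxIdx M Nt → ℂ) (V : Matrix (TxIdx M Nt) (TxIdx M Nt) ℂ),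
      D.R0.IsOptimal (w, V) →
      ∃ δ : D.S → ℝ, D.R1.IsOptimal (fun ρ => outer (w ρ), V, δ)) := by
  have hne : Nonempty (TxIdx M Nt) := ⟨(⟨0, hM⟩, ⟨0, hNt⟩)⟩
  have hiff := D.mem_R0_iff hNe hσ hσe hε
  have hdown := fun x => D.exists_mem_R0_of_mem_R1 hNe hσ hσe hε (x := x)
  refine ⟨le_antisymm ?_ ?_, D.exists_isOptimal_R1 hNe hε, ?_, ?_⟩
  · refine le_iInf₂ fun x hx => ?_
    obtain ⟨y, hy, hyx⟩ := hdown x hx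
    exact (iInf₂_le y hy).trans (EReal.coe_le_coe_iff.2 hyx)
  · refine le_iInf₂ fun ⟨w, V⟩ hx => ?_
    obtain ⟨δ, hδ⟩ := (hiff w V).1 hx
    exact iInf₂_le (fun ρ => outer (w ρ), V, δ) hδ
  · intro W V δ hopt
    obtain ⟨v, hv⟩ := D.exists_eq_outer_of_isOptimal_R1 hopt
    refine ⟨fun ρ => ?_, fun ρ => (hopt.1.1 ρ).1.exists_isPrincipalEigenpair,
      fun lam u hu => ?_⟩
    · rw [hv ρ]
      exact Matrix.rank_vecMulVec_le _ _
    · have hWu : ∀ ρ, W ρ = outer (((√(lam ρ) : ℝ) : ℂ) • u ρ) := by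
        intro ρ
        have := hu ρ
        rw [hv ρ] at this ⊢
        exact outer_eq_of_isPrincipalEigenpair this
      obtain rfl : W = fun ρ => outer (((√(lam ρ) : ℝ) : ℂ) • u ρ) := funext hWu
      refine ⟨hWu, (hiff _ V).2 ⟨δ, hopt.1⟩, fun ⟨w, V'⟩ hy => ?_⟩
      obtain ⟨δ', hδ'⟩ := (hiff w V').1 hy
      have hle := hopt.2 _ hδ'
      rwa [D.objective_outer w V' δ',
        D.objective_outer (fun ρ => ((√(lam ρ) : ℝ) : ℂ) • u ρ) V δ] at hle
  · intro w V hopt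
    obtain ⟨δ, hδ⟩ := (hiff w V).1 hopt.1
    refine ⟨δ, hδ, fun x hx => ?_⟩
    obtain ⟨y, hy, hyx⟩ := hdown x hx
    exact (hopt.2 y hy).trans hyx
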